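/- For integers $K,N\ge 1$ and a real $N\times K$ matrix $H$, consider the channel $y=Hb+n$ with $b$ uniformly distributed on $\{\pm1\}^K$ and independent noise $n\sim\mathcal N(0,\sigma^2 I_N)$. Let $P_e(\sigma)$ be the bit-error rate of the optimum detector, i.e. the infimum, over all measurable detectors $g:\mathbb R^N\to\{\pm1\}^K$ (which may depend on $H$ and $\sigma$), of $\frac1K\sum_{k=1}^K\Pr\big(g(y)_k\ne b_k\big)$. The optimum asymptotic multiuser efficiency of $H$ is $$\eta(H)=2\lim_{\sigma\to0^+}\sigma^2\log\frac1{P_e(\sigma)} .$$ Theorem. For all $K,N\geq 1$ let $H_{K,N}$ be a random $N\times K$ matrix whose entries are i.i.d. with law $\mathcal N(0,\frac1N)$, all these matrices being defined on one probability space (with an arbitrary joint law for different sizes). Then almost surely the following holds. For all $K,N\ge1$ the limit $\eta_{K,N}=\eta(H_{K,N})$ exists and $$\eta_{K,N}=\min_{x\in\{\pm1,0\}^K\setminus\{0\}}x^{T}H_{K,N}^{T}H_{K,N}\,x ,$$ and for every constant $c<\frac12$, $\eta_{K,N}\to1$ as $K,N\to\infty$ subject to $\frac{K}{N\log_3K}\le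 c$; that is, for every $\varepsilon>0$ there is $M$ such that $|\eta_{K,N}-1|<\varepsilon$ for all $K,N\ge M$ with $\frac{K}{N\log_3K}\le c$. -/

import Mathlib

open MeasureTheory ProbabilityTheory Filter Topology

noncomputable section

namespace CDMA

/-- The real vector with entries in `{±1}` given by the data (BPSK) vector `b`. -/
def dataVec {K : ℕ} (b : Fin K → ℤˣ) : Fin K → ℝ := fun k => ((b k : ℤ) : ℝ)

/-- The law `N(0, σ² I)` of the white Gaussian noise vector on `ℝ^N`. -/
def noiseLaw (N : ℕ) (σ : ℝ) : Measure (Fin N → ℝ) :=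
  Measure.pi fun _ => gaussianReal 0 (Real.toNNReal (σ ^ 2))

/-- The bit-error rate of the detector `g` for the channel `y = H b + n`, where `H` is fixed and
known, `b` is uniform on `{±1}^K` and `n ∼ N(0, σ² I)` is independent of `b`: the probability that
bit `k` is decided wrongly, averaged over the `K` users `k`. -/
def bitErrorRate {K N : ℕ} (H : Matrix (Fin N) (Fin K) ℝ) (σ : ℝ)
    (g : (Fin N → ℝ) → (Fin K → ℤˣ)) : ℝ :=
  (∑ k : Fin K, (∑ b : Fin K → ℤˣ,
    (noiseLaw N σ).real {n | g (H.mulVec (dataVec b) + n) k ≠ b k}) / 2 ^ K) / K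

/-- The bit-error rate `P_e(σ)` of the optimum detector: the smallest bit-error rate over all
measurable detectors. -/
def optimumBitErrorRate {K N : ℕ} (H : Matrix (Fin N) (Fin K) ℝ) (σ : ℝ) : ℝ :=
  ⨅ g : {g : (Fin N → ℝ) → (Fin K → ℤˣ) // Measurable g}, bitErrorRate H σ g.1

/-- `η` is the optimum asymptotic multiuser efficiency of the spreading matrix `H`:
`η = 2 lim_{σ → 0+} σ² log (1 / P_e(σ))`, and the limit exists. -/
def IsOptimumAsymptoticEfficiency {K N : ℕ} (H : Matrix (Fin N) (Fin K) ℝ) (η : ℝ) : Prop :=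
  Tendsto (fun σ : ℝ => 2 * (σ ^ 2 * Real.log (1 / optimumBitErrorRate H σ))) (𝓝[>] 0) (𝓝 η)

/-- The values `xᵀ R x`, with `R = Hᵀ H`, at the nonzero error vectors `x ∈ {±1, 0}^K`. -/
def errorEnergies {K N : ℕ} (H : Matrix (Fin N) (Fin K) ℝ) : Set ℝ :=
  {r | ∃ x : Fin K → ℝ, x ≠ 0 ∧ (∀ k, x k = 1 ∨ x k = -1 ∨ x k = 0) ∧
    r = x ⬝ᵥ (H.transpose * H).mulVec x}

end CDMA

end

namespace CDMA

/-! For fixed `H` both bounds on the optimum bit-error rate decay like `exp(-E / (2σ²))`, where `E`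
is the least energy `‖H x‖²` of a nonzero error vector. The minimum distance detector attains this
rate by a union bound over wrong data vectors (`bitErrorRate_minDistDetector_le`). Conversely, the
two signals at half difference of energy `E` are nearly equally likely close to their midpoint, so
no detector beats the rate (`exists_le_bitErrorRate`). The remaining factors disappear after
multiplication by `σ²`.

For random `H` an error vector with `w` nonzero entries has energy distributed as `(w/N) χ²_N`. A
single unit vector shows that `E` rarely exceeds `1 + ε`. For the lower bound, error vectors are
split at weight `W = K^(c+1/2)` (`measureReal_minEnergy_le`). Heavy vectors number at most `3^K ≤
exp(c N log K)`, but each has small energy with probability about `exp(-(N/2) log W)`, and `c < 1/2`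
makes this win. Light vectors number only `exp(o(N))`, against a probability exponentially small in
`N`. The resulting bounds are summable over pairs `(K, N)`, and Borel–Cantelli, which needs no
assumption on the joint law of the matrices, finishes the proof. -/

open Real in
/-- Chernoff's bound for an exponent with nonzero exponential moment. -/
lemma measureReal_le_exp_mul_integral_exp {Ω : Type*} [MeasurableSpace Ω] {P : Measure Ω}
    [IsProbabilityMeasure P] (Z : Ω → ℝ) (a : ℝ) (h : ∫ ω, exp (Z ω) ∂P ≠ 0) :
    P.real {ω | a ≤ Z ω} ≤ exp (-a) * ∫ ω, exp (Z ω) ∂P := by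
  -- A non-integrable function has Bochner integral 0, so a nonzero integral already gives
  -- integrability.
  have := measure_ge_le_exp_mul_mgf (μ := P) (X := Z) (t := 1) a zero_le_one
    (by simpa using not_imp_comm.1 integral_undef h)
  simpa [mgf] using this

/-! ### Energies of error vectors -/

/-- The squared norm of `H x`. -/
def energy {K N : ℕ} (H : Matrix (Fin N) (Fin K) ℝ) (x : Fin K → ℝ) : ℝ :=
  ∑ i, (H.mulVec x i) ^ 2

lemma dotProduct_mulVec_eq_energy {K N : ℕ} (H : Matrix (Fin N) (Fin K) ℝ) (x : Fin K → ℝ) :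
    x ⬝ᵥ (H.transpose * H).mulVec x = energy H x := by
  rw [← Matrix.mulVec_mulVec, Matrix.dotProduct_mulVec, Matrix.vecMul_transpose]
  simp [energy, dotProduct, sq]

/-- The real vector with entries in `{±1, 0}` given by a sign vector. -/
def signVec {K : ℕ} (s : Fin K → SignType) : Fin K → ℝ := fun k => (s k : ℝ)

lemma signVec_ne_zero_iff {K : ℕ} (s : Fin K → SignType) : signVec s ≠ 0 ↔ s ≠ 0 := by
  refine not_congr ⟨fun h => funext fun k => ?_, fun h => by ext; simp [signVec, h]⟩
  have := congrFun h k
  simp only [signVec] at this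
  cases hs : s k <;> simp_all

lemma errorEnergies_eq {K N : ℕ} (H : Matrix (Fin N) (Fin K) ℝ) :
    errorEnergies H = (fun s => energy H (signVec s)) '' {s | s ≠ 0} := by
  ext r
  constructor
  · rintro ⟨x, hx, hx', rfl⟩
    have : ∀ k, ∃ s : SignType, (s : ℝ) = x k := by
      intro k
      rcases hx' k with h | h | h
      · exact ⟨1, by simp [h]⟩
      · exact ⟨-1, by simp [h]⟩
      · exact ⟨0, by simp [h]⟩
    choose s hs using this
    have hsx : signVec s = x := funext hs
    exact ⟨s, (signVec_ne_zero_iff s).1 (hsx ▸ hx), by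
      rw [dotProduct_mulVec_eq_energy]; simp only [hsx]⟩
  · rintro ⟨s, hs, rfl⟩
    refine ⟨signVec s, (signVec_ne_zero_iff s).2 hs, fun k => ?_,
      (dotProduct_mulVec_eq_energy _ _).symm⟩
    simp only [signVec]
    cases s k <;> simp

/-- The least energy of a nonzero error vector. -/
noncomputable def minEnergy {K N : ℕ} (H : Matrix (Fin N) (Fin K) ℝ) : ℝ := sInf (errorEnergies H)

lemma isLeast_minEnergy {K N : ℕ} (hK : 1 ≤ K) (H : Matrix (Fin N) (Fin K) ℝ) :
    IsLeast (errorEnergies H) (minEnergy H) := by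
  have hfin : (errorEnergies H).Finite := by
    rw [errorEnergies_eq]; exact (Set.toFinite _).image _
  have hne : (errorEnergies H).Nonempty := by
    rw [errorEnergies_eq]
    exact ⟨_, fun _ => 1, fun h => by simpa using congrFun h ⟨0, hK⟩, rfl⟩
  exact ⟨hne.csInf_mem hfin, fun r hr => csInf_le hfin.bddBelow hr⟩

instance (N : ℕ) (σ : ℝ) : IsProbabilityMeasure (noiseLaw N σ) := by
  unfold noiseLaw; infer_instance

/-! ### Achievability: the minimum distance detector -/

section Detector

variable {K N : ℕ} (H : Matrix (Fin N) (Fin K) ℝ)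

/-- The data vectors whose signal is nearest to `y`. -/
def nearest (y : Fin N → ℝ) : Set (Fin K → ℤˣ) :=
  {b | ∀ b', ∑ i, (y i - H.mulVec (dataVec b) i) ^ 2 ≤ ∑ i, (y i - H.mulVec (dataVec b') i) ^ 2}

lemma nearest_nonempty (y : Fin N → ℝ) : (nearest H y).Nonempty := by
  obtain ⟨b, hb⟩ := Finite.exists_min
    (fun b : Fin K → ℤˣ => ∑ i, (y i - H.mulVec (dataVec b) i) ^ 2)
  exact ⟨b, hb⟩

open Classical in
/-- A minimum distance detector. -/
noncomputable def minDistDetector (y : Fin N → ℝ) : Fin K → ℤˣ :=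
  (fun S : Set (Fin K → ℤˣ) => if h : S.Nonempty then h.some else 1) (nearest H y)

lemma minDistDetector_mem (y : Fin N → ℝ) : minDistDetector H y ∈ nearest H y := by
  have h := nearest_nonempty H y
  simp only [minDistDetector, dif_pos h]
  exact h.some_mem

-- The detector factors through the finite type of sets of data vectors, so only `y ↦ nearest H y`
-- has to be measurable, and that is a matter of finitely many quadratic inequalities.
open Classical in
lemma measurable_minDistDetector : Measurable (minDistDetector H) := by
  refine Measurable.comp (g := fun S : Set (Fin K → ℤˣ) => if h : S.Nonempty then h.some else 1)
    (measurable_of_finite _) ?_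
  rw [measurable_set_iff]
  intro b
  have h : {y | b ∈ nearest H y} = ⋂ b', {y : Fin N → ℝ | ∑ i, (y i - H.mulVec (dataVec b) i) ^ 2 ≤
      ∑ i, (y i - H.mulVec (dataVec b') i) ^ 2} := by
    ext y; simp [nearest]
  refine measurableSet_setOfPred.1 (h ▸ MeasurableSet.iInter fun b' => ?_)
  exact measurableSet_le (by fun_prop) (by fun_prop)

open Real in
lemma integral_exp_sum_mul_noiseLaw (σ : ℝ) (u : Fin N → ℝ) :
    ∫ n, exp (∑ i, u i * n i) ∂noiseLaw N σ = exp (σ ^ 2 * (∑ i, u i ^ 2) / 2) := by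
  have h1 (i : Fin N) : ∫ x, exp (u i * x) ∂gaussianReal 0 (Real.toNNReal (σ ^ 2))
      = exp (σ ^ 2 * u i ^ 2 / 2) := by
    have := congrFun (mgf_fun_id_gaussianReal (μ := 0) (v := Real.toNNReal (σ ^ 2))) (u i)
    simpa [mgf, Real.coe_toNNReal _ (sq_nonneg σ)] using this
  simp_rw [exp_sum]
  rw [noiseLaw, integral_fintype_prod_eq_prod (f := fun i x => exp (u i * x))]
  simp_rw [h1]
  rw [← exp_sum, Finset.mul_sum, Finset.sum_div]

open Real in
/-- The probability that Gaussian noise has scalar product at least `‖u‖²` with `u`. -/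
lemma noiseLaw_real_halfspace_le {σ : ℝ} (hσ : 0 < σ) (u : Fin N → ℝ) :
    (noiseLaw N σ).real {n | ∑ i, u i ^ 2 ≤ ∑ i, u i * n i} ≤
      exp (-(∑ i, u i ^ 2) / (2 * σ ^ 2)) := by
  set E := ∑ i, u i ^ 2 with hE
  -- With tilt `t u` the Chernoff exponent is `-t E + σ² t² E / 2`, minimised at `t = 1/σ²`.
  have hint := integral_exp_sum_mul_noiseLaw (N := N) σ (fun i => u i / σ ^ 2)
  have h := measureReal_le_exp_mul_integral_exp (P := noiseLaw N σ)
    (fun n => ∑ i, u i / σ ^ 2 * n i) (E / σ ^ 2) (by rw [hint]; positivity)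
  rw [hint, ← exp_add] at h
  convert h using 3
  · ext n
    simp only [div_mul_eq_mul_div, ← Finset.sum_div]
    rw [div_le_div_iff_of_pos_right (by positivity)]
  · simp only [div_pow, ← Finset.sum_div, ← hE]
    field_simp
    ring

/-- Half the difference of two data vectors, a vector with entries in `{±1, 0}`. -/
lemma exists_signVec_of_ne {b b' : Fin K → ℤˣ} (h : b ≠ b') :
    ∃ s : Fin K → SignType, s ≠ 0 ∧ dataVec b - dataVec b' = (2 : ℝ) • signVec s := by
  have h0 (k : Fin K) : ∃ s : SignType, (dataVec b k - dataVec b' k = 2 * (s : ℝ)) ∧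
      (s = 0 → b k = b' k) := by
    rcases Int.units_eq_one_or (b k) with hb | hb <;>
    rcases Int.units_eq_one_or (b' k) with hb' | hb' <;> simp only [dataVec, hb, hb']
    · exact ⟨0, by simp⟩
    · exact ⟨1, by simp; norm_num⟩
    · exact ⟨-1, by simp; norm_num⟩
    · exact ⟨0, by simp⟩
  choose s hs hs0 using h0
  refine ⟨s, fun h0 => h (funext fun k => hs0 k (congrFun h0 k)), funext fun k => ?_⟩
  simpa [signVec] using hs k

-- If `b'` is decided instead of `b` and `b' - b = 2 s`, then `b'` is at least as near as `b`, which
-- puts the noise into the half-space `‖H s‖² ≤ ⟨H s, n⟩`. The factor `2 ^ K` counts the candidates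
-- `b'`.
open Real in
lemma bitErrorRate_minDistDetector_le (hK : 1 ≤ K) {σ : ℝ} (hσ : 0 < σ) :
    bitErrorRate H σ (minDistDetector H) ≤ 2 ^ K * exp (-minEnergy H / (2 * σ ^ 2)) := by
  have hcard : (Finset.univ : Finset (Fin K → ℤˣ)).card = 2 ^ K := by simp
  have key (b : Fin K → ℤˣ) (k : Fin K) : (noiseLaw N σ).real
      {n | minDistDetector H (H.mulVec (dataVec b) + n) k ≠ b k} ≤
      2 ^ K * exp (-minEnergy H / (2 * σ ^ 2)) := by
    have hb' (b' : Fin K → ℤˣ) : (noiseLaw N σ).real {n | b' ≠ b ∧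
        b' ∈ nearest H (H.mulVec (dataVec b) + n)} ≤ exp (-minEnergy H / (2 * σ ^ 2)) := by
      by_cases h : b' = b
      · simp only [h, ne_eq, not_true_eq_false, false_and, Set.ofPred_false, measureReal_empty]
        positivity
      obtain ⟨s, hs0, hs⟩ := exists_signVec_of_ne h
      have hmin : minEnergy H ≤ energy H (signVec s) :=
        (isLeast_minEnergy hK H).2 (by rw [errorEnergies_eq]; exact ⟨s, hs0, rfl⟩)
      have hu (i : Fin N) : H.mulVec (dataVec b') i =
          H.mulVec (dataVec b) i + 2 * H.mulVec (signVec s) i := by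
        have : dataVec b' = dataVec b + (2 : ℝ) • signVec s := by rw [← hs]; abel
        rw [this, Matrix.mulVec_add, Matrix.mulVec_smul]; simp
      refine le_trans (measureReal_mono ?_)
        ((noiseLaw_real_halfspace_le hσ (H.mulVec (signVec s))).trans ?_)
      · rintro n ⟨-, hn⟩
        have := hn b
        simp only [hu, Pi.add_apply, add_sub_cancel_left] at this
        have h2 : ∑ i, (H.mulVec (dataVec b) i + n i -
            (H.mulVec (dataVec b) i + 2 * H.mulVec (signVec s) i)) ^ 2 =
            ∑ i, n i ^ 2 + 4 * (∑ i, H.mulVec (signVec s) i ^ 2 -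
              ∑ i, H.mulVec (signVec s) i * n i) := by
          rw [← Finset.sum_sub_distrib, Finset.mul_sum, ← Finset.sum_add_distrib]
          exact Finset.sum_congr rfl fun i _ => by ring
        rw [h2] at this
        simp only [Set.mem_ofPred_eq]
        linarith
      · change exp (-energy H (signVec s) / _) ≤ _
        gcongr
    calc _ ≤ (noiseLaw N σ).real (⋃ b' ∈ (Finset.univ : Finset (Fin K → ℤˣ)), {n | b' ≠ b ∧
          b' ∈ nearest H (H.mulVec (dataVec b) + n)}) := by
            refine measureReal_mono (fun n hn => ?_) (measure_ne_top _ _)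
            simp only [Set.mem_iUnion]
            exact ⟨_, Finset.mem_univ _, fun h => hn (by rw [h]), minDistDetector_mem H _⟩
      _ ≤ ∑ b' ∈ (Finset.univ : Finset (Fin K → ℤˣ)), (noiseLaw N σ).real {n | b' ≠ b ∧
          b' ∈ nearest H (H.mulVec (dataVec b) + n)} := measureReal_biUnion_finset_le _ _
      _ ≤ ∑ b' ∈ (Finset.univ : Finset (Fin K → ℤˣ)), exp (-minEnergy H / (2 * σ ^ 2)) :=
          Finset.sum_le_sum fun b' _ => hb' b'
      _ = _ := by rw [Finset.sum_const, hcard]; simp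
  set C := 2 ^ K * exp (-minEnergy H / (2 * σ ^ 2)) with hC
  have hK' : (0 : ℝ) < K := by exact_mod_cast hK
  unfold bitErrorRate
  rw [div_le_iff₀ hK']
  calc _ ≤ ∑ k : Fin K, (∑ b : Fin K → ℤˣ, C) / 2 ^ K := by
        gcongr with k _ b _; exact key b k
    _ = C * K := by
        simp only [Finset.sum_const, hcard, Finset.card_univ, Fintype.card_fin, nsmul_eq_mul]
        push_cast; field_simp

end Detector

/-! ### Converse: two signals that no detector separates well -/

open Real in
lemma noiseLaw_eq_withDensity (N : ℕ) {σ : ℝ} (hσ : 0 < σ) :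
    noiseLaw N σ = (volume : Measure (Fin N → ℝ)).withDensity
      (fun x => ENNReal.ofReal (∏ i, gaussianPDFReal 0 (Real.toNNReal (σ ^ 2)) (x i))) := by
  have hv : Real.toNNReal (σ ^ 2) ≠ 0 := by simpa using hσ.ne'
  set v := Real.toNNReal (σ ^ 2)
  unfold noiseLaw
  refine Measure.pi_eq fun s hs => ?_
  rw [withDensity_apply _ (MeasurableSet.univ_pi hs), volume_pi, Measure.restrict_pi_pi,
    ← ofReal_integral_eq_lintegral_ofReal,
    integral_fintype_prod_eq_prod (f := fun _ x => gaussianPDFReal 0 v x),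
    ENNReal.ofReal_prod_of_nonneg]
  · exact Finset.prod_congr rfl fun i _ => (gaussianReal_apply_eq_integral 0 hv (s i)).symm
  · exact fun i _ => integral_nonneg fun x => gaussianPDFReal_nonneg 0 v x
  · exact Integrable.fintype_prod (f := fun _ x => gaussianPDFReal 0 v x)
      fun i => (integrable_gaussianPDFReal 0 v).integrableOn
  · exact ae_of_all _ fun x => Finset.prod_nonneg fun i _ => gaussianPDFReal_nonneg 0 v _

open Real in
/-- A lower bound on the Gaussian noise law by Lebesgue measure, on sets of bounded vectors. -/
lemma mul_volume_le_noiseLaw {N : ℕ} {σ : ℝ} (hσ : 0 < σ) {A : ℝ} {S : Set (Fin N → ℝ)}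
    (hS : MeasurableSet S) (hA : ∀ n ∈ S, ∑ i, n i ^ 2 ≤ A) :
    (√(2 * π * σ ^ 2))⁻¹ ^ N * exp (-A / (2 * σ ^ 2)) * (volume : Measure (Fin N → ℝ)).real S ≤
      (noiseLaw N σ).real S := by
  set q := (√(2 * π * σ ^ 2))⁻¹ ^ N * exp (-A / (2 * σ ^ 2)) with hq
  have hq0 : 0 ≤ q := by positivity
  have h : ENNReal.ofReal q * (volume : Measure (Fin N → ℝ)) S ≤ noiseLaw N σ S := by
    rw [noiseLaw_eq_withDensity N hσ, withDensity_apply _ hS, ← setLIntegral_const]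
    refine setLIntegral_mono' hS fun n hn => ENNReal.ofReal_le_ofReal ?_
    simp only [gaussianPDFReal, sub_zero, Real.coe_toNNReal _ (sq_nonneg σ)]
    rw [Finset.prod_mul_distrib, Finset.prod_const, ← exp_sum, ← Finset.sum_div,
      Finset.sum_neg_distrib, Finset.card_univ, Fintype.card_fin, hq]
    gcongr
    exact hA n hn
  have := ENNReal.toReal_mono (measure_ne_top _ _) h
  rwa [ENNReal.toReal_mul, ENNReal.toReal_ofReal hq0] at this

lemma measurableSet_singleton_intUnits (u : ℤˣ) : MeasurableSet ({u} : Set ℤˣ) := by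
  have : ({u} : Set ℤˣ) = Units.val ⁻¹' {(u : ℤ)} := by ext; simp [Units.ext_iff]
  exact this ▸ ⟨_, measurableSet_singleton _, rfl⟩

section TwoPoint

variable {K N : ℕ} (H : Matrix (Fin N) (Fin K) ℝ)

/-- Two data vectors at half difference `s`. -/
lemma exists_dataVec_pair (s : Fin K → SignType) : ∃ b b' : Fin K → ℤˣ,
    (∀ k, s k ≠ 0 → b k ≠ b' k) ∧ dataVec b - dataVec b' = (2 : ℝ) • signVec s := by
  have h0 (k : Fin K) : ∃ u u' : ℤˣ, (s k ≠ 0 → u ≠ u') ∧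
      (((u : ℤ) : ℝ) - ((u' : ℤ) : ℝ) = 2 * (s k : ℝ)) := by
    cases s k
    · exact ⟨1, 1, by simp⟩
    · exact ⟨-1, 1, by decide, by norm_num⟩
    · exact ⟨1, -1, by decide, by norm_num⟩
  choose b b' hb using h0
  exact ⟨b, b', fun k => (hb k).1, funext fun k => by simpa [dataVec, signVec] using (hb k).2⟩

/-- Young's inequality with weights `1 + 1/r` and `1 + r`. It bounds the noise needed to reach a
point within `r` of the midpoint of two signals `2u` apart; the excess over `‖u‖²` vanishes with
`r`. -/
lemma sum_sub_sq_le {ι : Type*} [Fintype ι] (a u : ι → ℝ) {r : ℝ} (hr : 0 < r)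
    (ha : ∑ i, a i ^ 2 < r ^ 2) :
    ∑ i, (a i - u i) ^ 2 ≤ (1 + r) * ∑ i, u i ^ 2 + r + r ^ 2 := by
  have h : ∀ i, (a i - u i) ^ 2 ≤ (1 + r⁻¹) * a i ^ 2 + (1 + r) * u i ^ 2 := fun i => by
    have : (1 + r⁻¹) * a i ^ 2 + (1 + r) * u i ^ 2 - (a i - u i) ^ 2 =
        r⁻¹ * (a i + r * u i) ^ 2 := by field_simp; ring
    nlinarith [this, mul_nonneg (inv_pos.2 hr).le (sq_nonneg (a i + r * u i))]
  have h2 := Finset.sum_le_sum fun i (_ : i ∈ Finset.univ) => h i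
  rw [Finset.sum_add_distrib, ← Finset.mul_sum, ← Finset.mul_sum] at h2
  have h3 : (1 + r⁻¹) * ∑ i, a i ^ 2 ≤ (1 + r⁻¹) * r ^ 2 := by gcongr
  have h4 : (1 + r⁻¹) * r ^ 2 = r + r ^ 2 := by field_simp; ring
  linarith

open Real in
/-- A lower bound on the bit-error rate of every detector. -/
lemma exists_le_bitErrorRate (hK : 1 ≤ K) {r : ℝ} (hr : 0 < r) : ∃ C : ℝ, 0 < C ∧
    ∀ σ : ℝ, 0 < σ → ∀ g : (Fin N → ℝ) → (Fin K → ℤˣ), Measurable g →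
      C * ((√(2 * π * σ ^ 2))⁻¹ ^ N *
        exp (-((1 + r) * minEnergy H + r + r ^ 2) / (2 * σ ^ 2))) ≤ bitErrorRate H σ g := by
  have hmem := (isLeast_minEnergy hK H).1
  rw [errorEnergies_eq] at hmem
  obtain ⟨s, hs, hsE⟩ := hmem
  obtain ⟨k, hk⟩ : ∃ k, s k ≠ 0 := Function.ne_iff.1 hs
  obtain ⟨b, b', hbk, hbb⟩ := exists_dataVec_pair s
  set u := H.mulVec (signVec s) with hu
  -- The midpoint of the two signals, which are `m + u` and `m - u`.
  set m : Fin N → ℝ := H.mulVec (dataVec b') + u with hm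
  have hm' : m = H.mulVec (dataVec b) - u := by
    have : dataVec b = dataVec b' + (2 : ℝ) • signVec s := by rw [← hbb]; abel
    rw [hm, this, Matrix.mulVec_add, Matrix.mulVec_smul, ← hu, two_smul]; abel
  set B : Set (Fin N → ℝ) := {y | ∑ i, (y i - m i) ^ 2 < r ^ 2} with hB
  have hBo : IsOpen B := isOpen_lt (by fun_prop) continuous_const
  have hBball : B ⊆ Metric.ball m r := by
    intro y hy
    rw [Metric.mem_ball, dist_pi_lt_iff hr]
    intro i
    have : (y i - m i) ^ 2 < r ^ 2 :=
      (Finset.single_le_sum (f := fun i => (y i - m i) ^ 2) (fun i _ => sq_nonneg _)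
        (Finset.mem_univ i)).trans_lt hy
    exact abs_lt_of_sq_lt_sq this hr.le
  have hBtop : (volume : Measure (Fin N → ℝ)) B ≠ ⊤ :=
    ((measure_mono hBball).trans_lt measure_ball_lt_top).ne
  have hBpos : 0 < (volume : Measure (Fin N → ℝ)).real B :=
    ENNReal.toReal_pos (hBo.measure_pos _ ⟨m, by simp [hB, hr]⟩).ne' hBtop
  have hK' : (0 : ℝ) < K := by exact_mod_cast hK
  refine ⟨(volume : Measure (Fin N → ℝ)).real B / 2 ^ K / K, by positivity, fun σ hσ g hg => ?_⟩
  set q := (√(2 * π * σ ^ 2))⁻¹ ^ N *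
        exp (-((1 + r) * minEnergy H + r + r ^ 2) / (2 * σ ^ 2)) with hq
  have key (c : Fin K → ℤˣ) (e : ℝ) (he : e ^ 2 = 1)
      (hc : ∀ i, H.mulVec (dataVec c) i = m i + e * u i) :
      q * (volume : Measure (Fin N → ℝ)).real (B ∩ {y | g y k ≠ c k}) ≤
        (noiseLaw N σ).real {n | g (H.mulVec (dataVec c) + n) k ≠ c k} := by
    have hmeas : MeasurableSet (B ∩ {y | g y k ≠ c k}) := by
      refine hBo.measurableSet.inter ?_
      exact ((measurable_pi_apply k).comp hg) (measurableSet_singleton_intUnits (c k)).compl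
    have hpre : MeasurableSet ((H.mulVec (dataVec c) + ·) ⁻¹' (B ∩ {y | g y k ≠ c k})) :=
      (measurable_const_add _) hmeas
    rw [measureReal_def volume, ← measure_preimage_add volume (H.mulVec (dataVec c)),
      ← measureReal_def]
    refine (mul_volume_le_noiseLaw hσ hpre fun n hn => ?_).trans
      (measureReal_mono fun n hn => hn.2)
    have h1 := sum_sub_sq_le (fun i => (H.mulVec (dataVec c) + n) i - m i)
      (fun i => e * u i) hr hn.1
    have h2 : ∑ i, (e * u i) ^ 2 = minEnergy H := by
      simp only [mul_pow, he, one_mul, ← hsE]; rfl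
    rw [h2] at h1
    refine le_trans (le_of_eq (Finset.sum_congr rfl fun i _ => ?_)) h1
    simp only [Pi.add_apply, hc]; ring
  have hbne : b ≠ b' := fun h => hbk k hk (by rw [h])
  have h1 := key b 1 (by norm_num) (fun i => by rw [hm']; simp)
  have h2 := key b' (-1) (by norm_num) (fun i => by rw [hm]; simp)
  -- As `b k ≠ b' k`, every decision on bit `k` is wrong for `b` or for `b'`, so the two error
  -- regions cover the ball.
  have hcover : (volume : Measure (Fin N → ℝ)).real B ≤
      (volume : Measure (Fin N → ℝ)).real (B ∩ {y | g y k ≠ b k}) +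
      (volume : Measure (Fin N → ℝ)).real (B ∩ {y | g y k ≠ b' k}) := by
    refine le_trans (measureReal_mono (fun y hy => ?_) ?_) (measureReal_union_le _ _)
    · by_cases h : g y k = b k
      · exact Or.inr ⟨hy, fun h' => hbk k hk (h.symm.trans h')⟩
      · exact Or.inl ⟨hy, h⟩
    · exact ((measure_mono (Set.union_subset Set.inter_subset_left
        Set.inter_subset_left)).trans_lt hBtop.lt_top).ne
  have hsum : q * (volume : Measure (Fin N → ℝ)).real B ≤ ∑ b : Fin K → ℤˣ,
      (noiseLaw N σ).real {n | g (H.mulVec (dataVec b) + n) k ≠ b k} := by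
    calc _ ≤ q * (_ + _) := mul_le_mul_of_nonneg_left hcover (by positivity)
      _ ≤ _ := by rw [mul_add]; exact add_le_add h1 h2
      _ = ∑ c ∈ ({b, b'} : Finset (Fin K → ℤˣ)),
          (noiseLaw N σ).real {n | g (H.mulVec (dataVec c) + n) k ≠ c k} :=
        (Finset.sum_pair hbne).symm
      _ ≤ _ := Finset.sum_le_sum_of_subset_of_nonneg (Finset.subset_univ _)
        fun _ _ _ => measureReal_nonneg
  calc _ = (q * (volume : Measure (Fin N → ℝ)).real B) / 2 ^ K / K := by ring
    _ ≤ (∑ b : Fin K → ℤˣ,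
      (noiseLaw N σ).real {n | g (H.mulVec (dataVec b) + n) k ≠ b k}) / 2 ^ K / K := by gcongr
    _ ≤ _ := by
      unfold bitErrorRate
      gcongr
      exact Finset.single_le_sum (f := fun k => (∑ b : Fin K → ℤˣ,
        (noiseLaw N σ).real {n | g (H.mulVec (dataVec b) + n) k ≠ b k}) / 2 ^ K)
        (fun k _ => div_nonneg (Finset.sum_nonneg fun _ _ => measureReal_nonneg)
          (by positivity)) (Finset.mem_univ k)

end TwoPoint

/-! ### The limit defining the efficiency -/

lemma bitErrorRate_nonneg {K N : ℕ} (H : Matrix (Fin N) (Fin K) ℝ) (σ : ℝ)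
    (g : (Fin N → ℝ) → (Fin K → ℤˣ)) : 0 ≤ bitErrorRate H σ g :=
  div_nonneg (Finset.sum_nonneg fun _ _ => div_nonneg
    (Finset.sum_nonneg fun _ _ => measureReal_nonneg) (by positivity)) (by positivity)

-- The Gaussian normalising constant does not affect the exponential rate.
open Real in
lemma tendsto_sq_mul_log_sqrt :
    Tendsto (fun σ : ℝ => σ ^ 2 * log (√(2 * π * σ ^ 2))) (𝓝[>] 0) (𝓝 0) := by
  have h1 : Tendsto (fun σ : ℝ => σ * (σ * log σ) + σ ^ 2 * (log (2 * π) / 2)) (𝓝 0)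
      (𝓝 (0 * (0 * log 0) + 0 ^ 2 * (log (2 * π) / 2))) :=
    ((continuous_id.mul continuous_mul_log).add (by fun_prop)).tendsto 0
  simp only [zero_mul, ne_eq, OfNat.ofNat_ne_zero, not_false_eq_true, zero_pow, add_zero] at h1
  refine (h1.mono_left nhdsWithin_le_nhds).congr' ?_
  filter_upwards [self_mem_nhdsWithin] with σ (hσ : 0 < σ)
  rw [log_sqrt (by positivity), log_mul (x := 2 * π) (y := σ ^ 2) (by positivity) (by positivity),
    log_pow]
  push_cast; ring

open Real in
theorem isOptimumAsymptoticEfficiency_minEnergy {K N : ℕ} (hK : 1 ≤ K)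
    (H : Matrix (Fin N) (Fin K) ℝ) : IsOptimumAsymptoticEfficiency H (minEnergy H) := by
  have hbdd (σ : ℝ) : BddBelow (Set.range fun g : {g : (Fin N → ℝ) → (Fin K → ℤˣ) //
      Measurable g} => bitErrorRate H σ g.1) :=
    ⟨0, by rintro _ ⟨g, rfl⟩; exact bitErrorRate_nonneg H σ g.1⟩
  have hne : Nonempty {g : (Fin N → ℝ) → (Fin K → ℤˣ) // Measurable g} :=
    ⟨⟨_, measurable_minDistDetector H⟩⟩
  have hlow (r : ℝ) (hr : 0 < r) : ∃ C : ℝ, 0 < C ∧ ∀ σ : ℝ, 0 < σ →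
      C * ((√(2 * π * σ ^ 2))⁻¹ ^ N *
        exp (-((1 + r) * minEnergy H + r + r ^ 2) / (2 * σ ^ 2))) ≤ optimumBitErrorRate H σ := by
    obtain ⟨C, hC, h⟩ := exists_le_bitErrorRate H hK hr
    exact ⟨C, hC, fun σ hσ => le_ciInf fun g => h σ hσ g.1 g.2⟩
  have hup (σ : ℝ) (hσ : 0 < σ) :
      optimumBitErrorRate H σ ≤ 2 ^ K * exp (-minEnergy H / (2 * σ ^ 2)) :=
    (ciInf_le (hbdd σ) ⟨_, measurable_minDistDetector H⟩).trans
      (bitErrorRate_minDistDetector_le H hK hσ)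
  have hpos (σ : ℝ) (hσ : 0 < σ) : 0 < optimumBitErrorRate H σ := by
    obtain ⟨C, hC, h⟩ := hlow 1 one_pos
    exact lt_of_lt_of_le (by positivity) (h σ hσ)
  have hsq : Tendsto (fun σ : ℝ => σ ^ 2) (𝓝[>] 0) (𝓝 0) := by
    have : Tendsto (fun σ : ℝ => σ ^ 2) (𝓝 0) (𝓝 (0 ^ 2)) := (continuous_pow 2).tendsto 0
    simpa using this.mono_left nhdsWithin_le_nhds
  refine tendsto_order.2 ⟨fun a ha => ?_, fun a ha => ?_⟩
  · have ht : Tendsto (fun σ : ℝ => minEnergy H - 2 * (σ ^ 2 * log (2 ^ K))) (𝓝[>] 0)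
        (𝓝 (minEnergy H - 2 * (0 * log (2 ^ K)))) :=
      tendsto_const_nhds.sub ((hsq.mul_const _).const_mul 2)
    filter_upwards [ht.eventually (lt_mem_nhds (by simpa using ha)), self_mem_nhdsWithin]
      with σ h1 (hσ : 0 < σ)
    refine h1.trans_le ?_
    have h2 := log_le_log (hpos σ hσ) (hup σ hσ)
    rw [log_mul (by positivity) (exp_pos _).ne', log_exp] at h2
    have h3 : σ ^ 2 * (minEnergy H / (2 * σ ^ 2)) = minEnergy H / 2 := by field_simp
    have h4 : σ ^ 2 * (minEnergy H / (2 * σ ^ 2) - log (2 ^ K)) ≤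
        σ ^ 2 * -log (optimumBitErrorRate H σ) := by
      gcongr; rw [neg_div] at h2; linarith
    rw [mul_sub, h3] at h4
    rw [one_div, log_inv]
    linarith
  -- The radius `r` is fixed before `σ → 0`, because the constant `C` of the converse depends on it.
  · obtain ⟨r, hr, hra⟩ : ∃ r : ℝ, 0 < r ∧ (1 + r) * minEnergy H + r + r ^ 2 < a := by
      have : Tendsto (fun r : ℝ => (1 + r) * minEnergy H + r + r ^ 2) (𝓝 0)
          (𝓝 ((1 + 0) * minEnergy H + 0 + 0 ^ 2)) :=
        Continuous.tendsto (by fun_prop) 0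
      have h := (this.mono_left (nhdsWithin_le_nhds (s := Set.Ioi 0))).eventually
        (gt_mem_nhds (by simpa using ha))
      obtain ⟨r, h1, h2⟩ := (h.and self_mem_nhdsWithin).exists
      exact ⟨r, h2, h1⟩
    obtain ⟨C, hC, h⟩ := hlow r hr
    set A := (1 + r) * minEnergy H + r + r ^ 2
    have ht : Tendsto (fun σ : ℝ => A + 2 * (N * (σ ^ 2 * log (√(2 * π * σ ^ 2))) -
        σ ^ 2 * log C)) (𝓝[>] 0) (𝓝 (A + 2 * (N * 0 - 0 * log C))) :=
      tendsto_const_nhds.add (((tendsto_sq_mul_log_sqrt.const_mul _).sub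
        (hsq.mul_const _)).const_mul 2)
    filter_upwards [ht.eventually (gt_mem_nhds (by simpa using hra)), self_mem_nhdsWithin]
      with σ h1 (hσ : 0 < σ)
    refine lt_of_le_of_lt ?_ h1
    have hs : 0 < √(2 * π * σ ^ 2) := by positivity
    have h2 := log_le_log (by positivity) (h σ hσ)
    rw [log_mul hC.ne' (by positivity), log_mul (by positivity) (exp_pos _).ne', log_exp,
      log_pow, log_inv] at h2
    have h3 : σ ^ 2 * (A / (2 * σ ^ 2)) = A / 2 := by field_simp
    have h4 : σ ^ 2 * -log (optimumBitErrorRate H σ) ≤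
        σ ^ 2 * (A / (2 * σ ^ 2) + (N * log (√(2 * π * σ ^ 2)) - log C)) := by
      gcongr; rw [neg_div] at h2; linarith
    rw [mul_add, h3] at h4
    rw [one_div, log_inv]
    linarith

/-! ### Tails of sums of Gaussian squares -/

section GaussianSquares

variable {Ω : Type*} [MeasurableSpace Ω] {P : Measure Ω}

open Real in
lemma integral_exp_neg_mul_sq_gaussianReal {v : NNReal} {t : ℝ} (h : 0 < 1 + 2 * t * v) :
    ∫ x, exp (-t * x ^ 2) ∂gaussianReal 0 v = (√(1 + 2 * t * v))⁻¹ := by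
  rcases eq_or_ne v 0 with rfl | hv
  · simp
  have hv' : (0 : ℝ) < v := NNReal.coe_pos.2 (pos_iff_ne_zero.2 hv)
  rw [integral_gaussianReal_eq_integral_smul hv]
  have h1 (x : ℝ) : gaussianPDFReal 0 v x • exp (-t * x ^ 2) =
      (√(2 * π * v))⁻¹ * exp (-((1 + 2 * t * v) / (2 * v)) * x ^ 2) := by
    rw [gaussianPDFReal, smul_eq_mul, mul_assoc, ← exp_add]
    congr 2
    field_simp
    ring
  simp_rw [h1]
  rw [integral_const_mul, integral_gaussian, ← sqrt_inv, ← sqrt_inv,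
    ← sqrt_mul (by positivity)]
  congr 1
  field_simp

open Real in
lemma integral_exp_neg_mul_sum_sq {N : ℕ} {Y : Fin N → Ω → ℝ} {v : NNReal}
    (hY : ∀ i, HasLaw (Y i) (gaussianReal 0 v) P) (hind : iIndepFun Y P) {t : ℝ}
    (h : 0 < 1 + 2 * t * v) :
    ∫ ω, exp (-t * ∑ i, Y i ω ^ 2) ∂P = exp (-(N / 2 * log (1 + 2 * t * v))) := by
  simp_rw [Finset.mul_sum, exp_sum]
  rw [hind.integral_fun_prod_comp (f := fun _ x => exp (-t * x ^ 2))
    (fun i => (hY i).aemeasurable) (fun i => by fun_prop)]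
  have h1 (i : Fin N) : ∫ ω, exp (-t * Y i ω ^ 2) ∂P = exp (-(1 / 2 * log (1 + 2 * t * v))) := by
    rw [← integral_map (hY i).aemeasurable (f := fun x => exp (-t * x ^ 2)) (by fun_prop),
      (hY i).map_eq, integral_exp_neg_mul_sq_gaussianReal h, exp_neg, ← mul_comm (log _),
      exp_mul, exp_log h, sqrt_eq_rpow]
  simp_rw [h1]
  rw [Finset.prod_const, ← exp_nat_mul]
  congr 1
  simp only [Finset.card_univ, Fintype.card_fin]
  ring

open Real in
/-- Lower tail of a sum of squares of independent centred Gaussians. -/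
lemma measureReal_sum_sq_le [IsProbabilityMeasure P] {N : ℕ} {Y : Fin N → Ω → ℝ} {v : NNReal}
    (hY : ∀ i, HasLaw (Y i) (gaussianReal 0 v) P) (hind : iIndepFun Y P) {t : ℝ}
    (ht : 0 < t) (a : ℝ) :
    P.real {ω | ∑ i, Y i ω ^ 2 ≤ a} ≤ exp (t * a - N / 2 * log (1 + 2 * t * v)) := by
  have hint := integral_exp_neg_mul_sum_sq hY hind (t := t) (by positivity)
  have := measureReal_le_exp_mul_integral_exp (P := P) (fun ω => -t * ∑ i, Y i ω ^ 2) (-t * a)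
    (by rw [hint]; positivity)
  rw [hint, ← exp_add] at this
  convert this using 3
  · ext ω; simp [ht]
  · ring

open Real in
/-- Upper tail of a sum of squares of independent centred Gaussians. -/
lemma measureReal_le_sum_sq [IsProbabilityMeasure P] {N : ℕ} {Y : Fin N → Ω → ℝ} {v : NNReal}
    (hY : ∀ i, HasLaw (Y i) (gaussianReal 0 v) P) (hind : iIndepFun Y P) {t : ℝ}
    (ht : 0 < t) (htv : 2 * t * v < 1) (a : ℝ) :
    P.real {ω | a ≤ ∑ i, Y i ω ^ 2} ≤ exp (-(t * a) - N / 2 * log (1 - 2 * t * v)) := by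
  have hint := integral_exp_neg_mul_sum_sq hY hind (t := -t) (by linarith)
  have := measureReal_le_exp_mul_integral_exp (P := P) (fun ω => - -t * ∑ i, Y i ω ^ 2) (t * a)
    (by rw [hint]; positivity)
  rw [hint, ← exp_add] at this
  convert this using 3
  · ext ω; simp [ht]
  · rw [show 1 + 2 * -t * (v : ℝ) = 1 - 2 * t * v by ring]; ring

end GaussianSquares

/-! ### The law of `H x` for a Gaussian matrix -/

section RandomMatrix

variable {Ω : Type*} [MeasurableSpace Ω] {P : Measure Ω} {K N : ℕ}
  {H : Ω → Matrix (Fin N) (Fin K) ℝ}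

/-- The number of nonzero entries of a sign vector. -/
def weight (s : Fin K → SignType) : NNReal := ∑ k, if s k = 0 then 0 else 1

lemma signVec_sq (s : Fin K → SignType) (k : Fin K) :
    signVec s k ^ 2 = ((if s k = 0 then 0 else 1 : NNReal) : ℝ) := by
  simp only [signVec]
  cases s k <;> simp

lemma one_le_weight {s : Fin K → SignType} (hs : s ≠ 0) : 1 ≤ weight s := by
  obtain ⟨k, hk⟩ : ∃ k, s k ≠ 0 := Function.ne_iff.1 hs
  have := Finset.single_le_sum (f := fun k => if s k = 0 then (0 : NNReal) else 1)
    (fun _ _ => zero_le) (Finset.mem_univ k)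
  simpa [hk, weight] using this

lemma covariance_mulVec [IsProbabilityMeasure P]
    (hlaw : ∀ i j, HasLaw (fun ω => H ω i j) (gaussianReal 0 (1 / (N : NNReal))) P)
    (hindep : iIndepFun (fun (p : Fin N × Fin K) (ω : Ω) => H ω p.1 p.2) P)
    (x : Fin K → ℝ) (i i' : Fin N) :
    cov[fun ω => (H ω).mulVec x i, fun ω => (H ω).mulVec x i'; P] =
      if i = i' then (∑ k, x k ^ 2) * (1 / (N : NNReal) : NNReal) else 0 := by
  have hL2 (i : Fin N) (j : Fin K) : MemLp (fun ω => H ω i j) 2 P :=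
    (hlaw i j).hasGaussianLaw.memLp_two
  have hL2' (i : Fin N) (j : Fin K) : MemLp (fun ω => H ω i j * x j) 2 P := (hL2 i j).mul_const _
  simp only [Matrix.mulVec, dotProduct]
  rw [covariance_fun_sum_fun_sum (fun j => hL2' i j) (fun j => hL2' i' j)]
  simp_rw [covariance_mul_const_left, covariance_mul_const_right]
  have hcov (i i' : Fin N) (j j' : Fin K) (h : (i, j) ≠ (i', j')) :
      cov[fun ω => H ω i j, fun ω => H ω i' j'; P] = 0 :=
    (hindep.indepFun h).covariance_eq_zero (hL2 i j) (hL2 i' j')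
  have hvar (i : Fin N) (j : Fin K) :
      cov[fun ω => H ω i j, fun ω => H ω i j; P] = (1 / (N : NNReal) : NNReal) := by
    rw [covariance_self (hlaw i j).aemeasurable, (hlaw i j).variance_eq, variance_id_gaussianReal]
  split_ifs with h
  · subst h
    rw [Finset.sum_mul]
    refine Finset.sum_congr rfl fun j _ => ?_
    rw [Finset.sum_eq_single j, hvar]
    · ring
    · intro j' _ hj'
      rw [hcov _ _ _ _ (by simpa using hj'.symm)]; ring
    · simp
  · refine Finset.sum_eq_zero fun j _ => Finset.sum_eq_zero fun j' _ => ?_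
    rw [hcov _ _ _ _ (by simp [h])]; ring

lemma hasGaussianLaw_mulVec
    (hlaw : ∀ i j, HasLaw (fun ω => H ω i j) (gaussianReal 0 (1 / (N : NNReal))) P)
    (hindep : iIndepFun (fun (p : Fin N × Fin K) (ω : Ω) => H ω p.1 p.2) P)
    (x : Fin K → ℝ) :
    HasGaussianLaw (fun ω i => (H ω).mulVec x i) P := by
  have h := iIndepFun.hasGaussianLaw
    (fun p : Fin N × Fin K => (hlaw p.1 p.2).hasGaussianLaw) hindep
  let L : (Fin N × Fin K → ℝ) →L[ℝ] (Fin N → ℝ) :=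
    ContinuousLinearMap.pi fun i => ∑ j, x j • ContinuousLinearMap.proj (i, j)
  convert! h.map_fun L using 1
  ext ω i
  simp [L, Matrix.mulVec, dotProduct, mul_comm]

/-- The coordinates of `H x` are jointly Gaussian, as linear images of independent Gaussians, so
being uncorrelated makes them independent. -/
lemma iIndepFun_mulVec [IsProbabilityMeasure P]
    (hlaw : ∀ i j, HasLaw (fun ω => H ω i j) (gaussianReal 0 (1 / (N : NNReal))) P)
    (hindep : iIndepFun (fun (p : Fin N × Fin K) (ω : Ω) => H ω p.1 p.2) P)
    (x : Fin K → ℝ) : iIndepFun (fun i ω => (H ω).mulVec x i) P :=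
  (hasGaussianLaw_mulVec hlaw hindep x).iIndepFun_of_covariance_eq_zero fun i i' h => by
    rw [covariance_mulVec hlaw hindep, if_neg h]

lemma hasLaw_mulVec_signVec [IsProbabilityMeasure P]
    (hlaw : ∀ i j, HasLaw (fun ω => H ω i j) (gaussianReal 0 (1 / (N : NNReal))) P)
    (hindep : iIndepFun (fun (p : Fin N × Fin K) (ω : Ω) => H ω p.1 p.2) P)
    (s : Fin K → SignType) (i : Fin N) :
    HasLaw (fun ω => (H ω).mulVec (signVec s) i) (gaussianReal 0 (weight s / N)) P := by
  have hG := (hasGaussianLaw_mulVec hlaw hindep (signVec s)).eval i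
  refine ⟨hG.aemeasurable, ?_⟩
  rw [hG.map_eq_gaussianReal]
  congr 1
  · simp only [Matrix.mulVec, dotProduct]
    rw [integral_finsetSum _ fun j _ => ((hlaw i j).hasGaussianLaw.integrable).mul_const _]
    refine Finset.sum_eq_zero fun j _ => ?_
    rw [integral_mul_const, (hlaw i j).integral_eq, integral_id_gaussianReal, zero_mul]
  · rw [← covariance_self hG.aemeasurable, covariance_mulVec hlaw hindep, if_pos rfl]
    simp_rw [signVec_sq]
    rw [← NNReal.coe_sum, ← NNReal.coe_mul, Real.toNNReal_coe]
    simp [weight, div_eq_mul_inv]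

open Real in
lemma measureReal_energy_le [IsProbabilityMeasure P]
    (hlaw : ∀ i j, HasLaw (fun ω => H ω i j) (gaussianReal 0 (1 / (N : NNReal))) P)
    (hindep : iIndepFun (fun (p : Fin N × Fin K) (ω : Ω) => H ω p.1 p.2) P)
    (hN : 1 ≤ N) (s : Fin K → SignType) {r : ℝ} (hr : 0 < r) (a : ℝ) :
    P.real {ω | energy (H ω) (signVec s) ≤ a} ≤
      exp (-(N / 2 * (log (1 + r * weight s) - r * a))) := by
  have hN' : (0 : ℝ) < N := by exact_mod_cast hN
  refine (measureReal_sum_sq_le (hasLaw_mulVec_signVec hlaw hindep s)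
    (iIndepFun_mulVec hlaw hindep (signVec s)) (t := r * N / 2) (by positivity) a).trans_eq ?_
  have hv : 2 * (r * N / 2) * ((weight s / N : NNReal) : ℝ) = r * weight s := by
    push_cast; field_simp
  rw [hv]
  congr 1
  ring

open Real in
lemma measureReal_le_energy_single [IsProbabilityMeasure P]
    (hlaw : ∀ i j, HasLaw (fun ω => H ω i j) (gaussianReal 0 (1 / (N : NNReal))) P)
    (hindep : iIndepFun (fun (p : Fin N × Fin K) (ω : Ω) => H ω p.1 p.2) P)
    (hN : 1 ≤ N) (k : Fin K) {r : ℝ} (hr : 0 < r) (hr1 : r < 1)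
    (a : ℝ) :
    P.real {ω | a ≤ energy (H ω) (signVec (Pi.single k 1))} ≤
      exp (-(N / 2 * (log (1 - r) + r * a))) := by
  have hN' : (0 : ℝ) < N := by exact_mod_cast hN
  have hw : weight (Pi.single k 1 : Fin K → SignType) = 1 := by
    unfold weight
    rw [Finset.sum_eq_single k] <;> simp +contextual
  have hv : 2 * (r * N / 2) * ((weight (Pi.single k 1 : Fin K → SignType) / N : NNReal) : ℝ) = r := by
    rw [hw]; push_cast; field_simp
  refine (measureReal_le_sum_sq (hasLaw_mulVec_signVec hlaw hindep (Pi.single k 1))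
    (iIndepFun_mulVec hlaw hindep _) (t := r * N / 2) (by positivity) (by rwa [hv]) a).trans_eq ?_
  rw [hv]
  congr 1
  ring

end RandomMatrix

/-! ### Union bound over error vectors -/

-- The sum factorises over coordinates: the entry 0 contributes 1 and each of `±1` contributes `exp
-- (-l)`.
open Real in
lemma sum_exp_neg_mul_weight (K : ℕ) (l : ℝ) :
    ∑ s : Fin K → SignType, exp (-l * weight s) = (1 + 2 * exp (-l)) ^ K := by
  have h1 (s : Fin K → SignType) :
      exp (-l * weight s) = ∏ k, exp (-l * ((if s k = 0 then 0 else 1 : NNReal) : ℝ)) := by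
    rw [← exp_sum, ← Finset.mul_sum, weight, NNReal.coe_sum]
  have h2 : (Finset.univ : Finset SignType) = {0, -1, 1} := by decide
  simp_rw [h1]
  rw [← Fintype.sum_pow (fun a : SignType => exp (-l * ((if a = 0 then 0 else 1 : NNReal) : ℝ))),
    h2]
  congr 1
  rw [Finset.sum_insert (by decide), Finset.sum_pair (by decide)]
  simp
  ring

section UnionBound

variable {Ω : Type*} [MeasurableSpace Ω] {P : Measure Ω} [IsProbabilityMeasure P] {K N : ℕ}
  {H : Ω → Matrix (Fin N) (Fin K) ℝ}

open Real in
/-- The probability that the least energy is small. Error vectors of weight at least `W` and of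
weight less than `W` are counted apart. -/
lemma measureReal_minEnergy_le
    (hlaw : ∀ i j, HasLaw (fun ω => H ω i j) (gaussianReal 0 (1 / (N : NNReal))) P)
    (hindep : iIndepFun (fun (p : Fin N × Fin K) (ω : Ω) => H ω p.1 p.2) P)
    (hK : 1 ≤ K) (hN : 1 ≤ N) {ε : ℝ} (hε : 0 < ε) {W : ℝ} (hW : 0 ≤ W) :
    P.real {ω | minEnergy (H ω) ≤ 1 - ε} ≤
      exp (K * log 3 - N / 2 * (log (1 + W) - 1)) +
      exp (W * log K + 2 - N / 2 * (log (1 + ε) - ε * (1 - ε))) := by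
  classical
  have hK' : (0 : ℝ) < K := by exact_mod_cast hK
  have hlogK : 0 ≤ log (K : ℝ) := log_nonneg (by exact_mod_cast hK)
  have hN' : (0 : ℝ) < N := by exact_mod_cast hN
  set A := exp (-(N / 2 * (log (1 + W) - 1))) with hA
  set B := exp (-(N / 2 * (log (1 + ε) - ε * (1 - ε)))) with hB
  -- The factor `K^(W - weight s)` is at least 1 on light vectors, and its sum over all sign vectors
  -- is `K^W (1 + 2/K)^K ≤ K^W e²`. This counts light vectors without binomial coefficients.
  have hterm (s : Fin K → SignType) (hs : s ≠ 0) :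
      P.real {ω | energy (H ω) (signVec s) ≤ 1 - ε} ≤
        A + B * exp (W * log K) * exp (-log K * weight s) := by
    have hw : (1 : ℝ) ≤ weight s := by exact_mod_cast one_le_weight hs
    rcases le_total W (weight s) with h | h
    · refine (measureReal_energy_le hlaw hindep hN s one_pos (1 - ε)).trans ?_
      refine le_trans ?_ (le_add_of_nonneg_right (by positivity))
      rw [hA]
      gcongr <;> linarith
    · refine (measureReal_energy_le hlaw hindep hN s hε (1 - ε)).trans ?_
      refine le_trans ?_ (le_add_of_nonneg_left (by positivity))
      have h1 : 1 ≤ exp (W * log K) * exp (-log K * weight s) := by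
        rw [← exp_add]
        exact one_le_exp (by nlinarith)
      rw [mul_assoc]
      refine le_trans ?_ (le_mul_of_one_le_right (by positivity) h1)
      rw [hB]
      gcongr
      nlinarith
  have hcover : {ω | minEnergy (H ω) ≤ 1 - ε} ⊆
      ⋃ s ∈ Finset.univ.filter (fun s : Fin K → SignType => s ≠ 0),
        {ω | energy (H ω) (signVec s) ≤ 1 - ε} := by
    intro ω hω
    have hmem := (isLeast_minEnergy hK (H ω)).1
    rw [errorEnergies_eq] at hmem
    obtain ⟨s, hs, hsE⟩ := hmem
    simp only [Set.mem_iUnion]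
    exact ⟨s, by simpa using hs, hsE.trans_le hω⟩
  calc _ ≤ P.real (⋃ s ∈ Finset.univ.filter (fun s : Fin K → SignType => s ≠ 0),
        {ω | energy (H ω) (signVec s) ≤ 1 - ε}) := measureReal_mono hcover (measure_ne_top _ _)
    _ ≤ ∑ s ∈ Finset.univ.filter (fun s : Fin K → SignType => s ≠ 0),
        P.real {ω | energy (H ω) (signVec s) ≤ 1 - ε} := measureReal_biUnion_finset_le _ _
    _ ≤ ∑ s ∈ Finset.univ.filter (fun s : Fin K → SignType => s ≠ 0),
        (A + B * exp (W * log K) * exp (-log K * weight s)) :=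
      Finset.sum_le_sum fun s hs => hterm s (by simpa using hs)
    _ ≤ ∑ s : Fin K → SignType, (A + B * exp (W * log K) * exp (-log K * weight s)) :=
      Finset.sum_le_sum_of_subset_of_nonneg (Finset.subset_univ _) fun _ _ _ => by positivity
    _ = 3 ^ K * A + B * exp (W * log K) * (1 + 2 * exp (-log K)) ^ K := by
      rw [Finset.sum_add_distrib, ← Finset.mul_sum, sum_exp_neg_mul_weight, Finset.sum_const,
        nsmul_eq_mul, Finset.card_univ, Fintype.card_fun, Fintype.card_fin]
      congr 2
      norm_cast
    _ ≤ exp (K * log 3) * A + B * exp (W * log K) * exp 2 := by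
      gcongr
      · rw [exp_nat_mul, exp_log (by norm_num)]
      · rw [exp_neg, exp_log hK']
        calc (1 + 2 * (K : ℝ)⁻¹) ^ K ≤ exp (2 * (K : ℝ)⁻¹) ^ K := by
              gcongr; rw [add_comm]; exact add_one_le_exp _
          _ = exp 2 := by rw [← exp_nat_mul]; congr 1; field_simp
    _ = _ := by
      rw [hA, hB, ← exp_add, ← exp_add, ← exp_add]
      congr 2
      all_goals ring

open Real in
/-- The probability that the least energy is large. -/
lemma measureReal_le_minEnergy
    (hlaw : ∀ i j, HasLaw (fun ω => H ω i j) (gaussianReal 0 (1 / (N : NNReal))) P)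
    (hindep : iIndepFun (fun (p : Fin N × Fin K) (ω : Ω) => H ω p.1 p.2) P)
    (hK : 1 ≤ K) (hN : 1 ≤ N) {r : ℝ} (hr : 0 < r) (hr1 : r < 1) (a : ℝ) :
    P.real {ω | a ≤ minEnergy (H ω)} ≤ exp (-(N / 2 * (log (1 - r) + r * a))) := by
  refine le_trans (measureReal_mono fun ω hω => ?_)
    (measureReal_le_energy_single hlaw hindep hN (⟨0, hK⟩ : Fin K) hr hr1 a)
  refine le_trans (b := minEnergy (H ω)) hω ((isLeast_minEnergy hK (H ω)).2 ?_)
  rw [errorEnergies_eq]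
  exact ⟨_, by simp, rfl⟩

end UnionBound

/-! ### Choice of the weight threshold, and Borel–Cantelli -/

-- The exponent `c + 1/2` is the midpoint of `2c` and 1: above `2c`, so that heavy vectors are
-- beaten, and below 1, so that light vectors are few. The bound `K ≤ N²` serves summability.
open Real in
lemma exists_threshold {c : ℝ} (hc0 : 0 < c) (hc : c < 1 / 2) {δ : ℝ} (hδ : 0 < δ) :
    ∃ M : ℕ, 2 ≤ M ∧ ∀ K N : ℕ, M ≤ K → M ≤ N → (K : ℝ) / (N * logb 3 K) ≤ c →
      (K : ℝ) ≤ N ^ 2 ∧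
      K * log 3 - N / 2 * (log (1 + (K : ℝ) ^ (c + 1 / 2)) - 1) ≤ -N ∧
      (K : ℝ) ^ (c + 1 / 2) * log K + 2 ≤ N * δ := by
  have hlog3 : 1 ≤ log 3 := by
    rw [le_log_iff_exp_le (by norm_num)]
    exact exp_one_lt_three.le
  have hθ : 0 < 1 - (c + 1 / 2) := by linarith
  -- Of the `3/2`, `1/2` absorbs the `-1` beside the logarithm and 1 yields the bound `-N`.
  have e1 : ∀ᶠ x : ℝ in atTop, 3 / 2 ≤ (1 / 4 - c / 2) * log x :=
    (tendsto_log_atTop.const_mul_atTop (by linarith)).eventually_ge_atTop _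
  have e2 : ∀ᶠ x : ℝ in atTop, x ^ (c + 1 / 2) * log x ^ 2 ≤ δ / 2 * x := by
    have h := (isLittleO_log_rpow_rpow_atTop 2 hθ).bound (half_pos hδ)
    filter_upwards [h, eventually_gt_atTop 0] with x hx hx0
    rw [rpow_two, norm_of_nonneg (sq_nonneg _), norm_of_nonneg (by positivity)] at hx
    calc x ^ (c + 1 / 2) * log x ^ 2 ≤ x ^ (c + 1 / 2) * (δ / 2 * x ^ (1 - (c + 1 / 2))) := by
          gcongr
      _ = δ / 2 * (x ^ (c + 1 / 2) * x ^ (1 - (c + 1 / 2))) := by ring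
      _ = δ / 2 * x := by rw [← rpow_add hx0]; simp
  have e3 : ∀ᶠ x : ℝ in atTop, log x ^ 2 ≤ x := by
    filter_upwards [(isLittleO_log_rpow_rpow_atTop 2 one_pos).bound one_pos,
      eventually_gt_atTop 0] with x hx hx0
    rw [rpow_two, rpow_one, norm_of_nonneg (sq_nonneg _), norm_of_nonneg hx0.le] at hx
    linarith
  have e4 : ∀ᶠ x : ℝ in atTop, 2 ≤ x * (δ / 2) :=
    (tendsto_id.atTop_mul_const (half_pos hδ)).eventually_ge_atTop _
  obtain ⟨M, hM⟩ := eventually_atTop.1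
    (tendsto_natCast_atTop_atTop.eventually (e1.and (e2.and (e3.and e4))))
  -- At `K = 1` the quotient is 0 by convention and the rate condition says nothing; `K ≥ 2` makes
  -- `log K` positive.
  refine ⟨max M 2, le_max_right _ _, fun K N hK hN hKN => ?_⟩
  obtain ⟨h1, h2, h3, -⟩ := hM K ((le_max_left _ _).trans hK)
  obtain ⟨-, -, -, h4⟩ := hM N ((le_max_left _ _).trans hN)
  have hK2 : (2 : ℝ) ≤ K := by exact_mod_cast (le_max_right _ _).trans hK
  have hN2 : (2 : ℝ) ≤ N := by exact_mod_cast (le_max_right _ _).trans hN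
  have hL : 0 < log (K : ℝ) := log_pos (by linarith)
  have hK0 : (0 : ℝ) < K := by linarith
  have hN0 : (0 : ℝ) < N := by linarith
  have hmain : K * log 3 ≤ c * N * log K := by
    rw [logb, div_le_iff₀ (by positivity)] at hKN
    calc K * log 3 ≤ c * (N * (log K / log 3)) * log 3 := by gcongr
      _ = _ := by field_simp
  have hKle : (K : ℝ) ≤ N * log K := by
    have : 0 < N * log (K : ℝ) := by positivity
    nlinarith
  refine ⟨?_, ?_, ?_⟩
  · have : (K : ℝ) ^ 2 ≤ N ^ 2 * K := by
      calc (K : ℝ) ^ 2 ≤ (N * log K) ^ 2 := by gcongr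
        _ = N ^ 2 * log K ^ 2 := by ring
        _ ≤ _ := by gcongr
    nlinarith
  · have hlog : (c + 1 / 2) * log K ≤ log (1 + (K : ℝ) ^ (c + 1 / 2)) := by
      rw [← log_rpow hK0]
      exact log_le_log (by positivity) (by linarith)
    nlinarith
  · have : (K : ℝ) ^ (c + 1 / 2) * log K * log K ≤ δ / 2 * N * log K := by
      calc _ = (K : ℝ) ^ (c + 1 / 2) * log K ^ 2 := by ring
        _ ≤ δ / 2 * K := h2
        _ ≤ δ / 2 * (N * log K) := by gcongr
        _ = _ := by ring
    have := le_of_mul_le_mul_right this hL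
    linarith

-- The sixth Taylor term of `exp` suffices, since `N⁶ = (N²)² N² ≥ K² N²`; this is summable over
-- both indices.
open Real in
lemma exp_neg_mul_le {γ : ℝ} (hγ : 0 < γ) {K N : ℕ} (hK : 1 ≤ K) (hN : 1 ≤ N)
    (hKN : (K : ℝ) ≤ N ^ 2) :
    exp (-(N * γ)) ≤ 720 / γ ^ 6 * (1 / (K : ℝ) ^ 2 * (1 / (N : ℝ) ^ 2)) := by
  have hK' : (0 : ℝ) < K := by exact_mod_cast hK
  have hN' : (0 : ℝ) < N := by exact_mod_cast hN
  have h := pow_div_factorial_le_exp (x := N * γ) (by positivity) 6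
  have h2 : γ ^ 6 / 720 * ((K : ℝ) ^ 2 * N ^ 2) ≤ exp (N * γ) := by
    refine le_trans ?_ h
    calc γ ^ 6 / 720 * ((K : ℝ) ^ 2 * N ^ 2) ≤ γ ^ 6 / 720 * (((N : ℝ) ^ 2) ^ 2 * N ^ 2) := by
          gcongr
      _ = _ := by simp [Nat.factorial]; ring
  rw [exp_neg]
  calc (exp (N * γ))⁻¹ ≤ (γ ^ 6 / 720 * ((K : ℝ) ^ 2 * N ^ 2))⁻¹ := by gcongr
    _ = _ := by field_simp

open Real in
/-- Concentration of the least energy around one, at a summable rate. -/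
lemma exists_measureReal_minEnergy_dev_le {Ω : Type*} [MeasurableSpace Ω] (P : Measure Ω)
    [IsProbabilityMeasure P] (H : ∀ K N : ℕ, Ω → Matrix (Fin N) (Fin K) ℝ)
    (hlaw : ∀ (K N : ℕ) (i : Fin N) (j : Fin K),
      HasLaw (fun ω => H K N ω i j) (gaussianReal 0 (1 / (N : NNReal))) P)
    (hindep : ∀ K N : ℕ, iIndepFun (fun (p : Fin N × Fin K) (ω : Ω) => H K N ω p.1 p.2) P)
    {c : ℝ} (hc0 : 0 < c) (hc : c < 1 / 2) {ε : ℝ} (hε : 0 < ε) (hε1 : ε < 1) :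
    ∃ M : ℕ, ∃ C : ℝ, ∀ K N : ℕ, M ≤ K → M ≤ N → (K : ℝ) / (N * logb 3 K) ≤ c →
      P.real {ω | ε ≤ |minEnergy (H K N ω) - 1|} ≤ C * (1 / (K : ℝ) ^ 2 * (1 / (N : ℝ) ^ 2)) := by
  -- The exponent for light vectors is `(N/2) · 4δ = 2Nδ`; their count uses up `Nδ` of it. Both `δ`
  -- and `δ'` are positive by `log x ≥ 1 - 1/x`.
  set δ := (log (1 + ε) - ε * (1 - ε)) / 4 with hδ
  set δ' := (log (1 - ε / 2) + ε / 2 * (1 + ε)) / 2 with hδ'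
  have hδ0 : 0 < δ := by
    have h1 := one_sub_inv_le_log_of_pos (x := 1 + ε) (by linarith)
    have h2 : 1 - (1 + ε)⁻¹ - ε * (1 - ε) = ε ^ 3 / (1 + ε) := by field_simp; ring
    have : 0 < ε ^ 3 / (1 + ε) := by positivity
    rw [hδ]; linarith
  have hδ'0 : 0 < δ' := by
    have h0 : 0 < 1 - ε / 2 := by linarith
    have h1 := one_sub_inv_le_log_of_pos h0
    have h2 : 1 - (1 - ε / 2)⁻¹ + ε / 2 * (1 + ε) =
        ε ^ 2 * (1 - ε) / 4 / (1 - ε / 2) := by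
      have : 2 - ε ≠ 0 := by linarith
      field_simp; ring
    have : 0 < ε ^ 2 * (1 - ε) / 4 / (1 - ε / 2) := by
      have : 0 < 1 - ε := by linarith
      positivity
    rw [hδ']; linarith
  obtain ⟨M, hM2, hM⟩ := exists_threshold hc0 hc hδ0
  refine ⟨M, 720 / 1 ^ 6 + 720 / δ ^ 6 + 720 / δ' ^ 6, fun K N hK hN hKN => ?_⟩
  obtain ⟨h1, h2, h3⟩ := hM K N hK hN hKN
  have hK1 : 1 ≤ K := by omega
  have hN1 : 1 ≤ N := by omega
  have b1 := measureReal_minEnergy_le (hlaw K N) (hindep K N) hK1 hN1 hε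
    (W := (K : ℝ) ^ (c + 1 / 2)) (by positivity)
  have b2 := measureReal_le_minEnergy (hlaw K N) (hindep K N) hK1 hN1 (r := ε / 2)
    (by linarith) (by linarith) (1 + ε)
  have hsub : {ω | ε ≤ |minEnergy (H K N ω) - 1|} ⊆
      {ω | minEnergy (H K N ω) ≤ 1 - ε} ∪ {ω | 1 + ε ≤ minEnergy (H K N ω)} := by
    intro ω hω
    rcases le_abs.1 (show ε ≤ |minEnergy (H K N ω) - 1| from hω) with h | h
    · exact Or.inr (show 1 + ε ≤ minEnergy (H K N ω) by linarith)
    · exact Or.inl (show minEnergy (H K N ω) ≤ 1 - ε by linarith)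
  have c1 : exp (K * log 3 - N / 2 * (log (1 + (K : ℝ) ^ (c + 1 / 2)) - 1)) ≤
      exp (-(N * 1)) := exp_le_exp.2 (by linarith)
  have c2 : exp ((K : ℝ) ^ (c + 1 / 2) * log K + 2 - N / 2 * (log (1 + ε) - ε * (1 - ε))) ≤
      exp (-(N * δ)) := exp_le_exp.2 (by
        have : N / 2 * (log (1 + ε) - ε * (1 - ε)) = 2 * (N * δ) := by rw [hδ]; ring
        linarith)
  have c3 : exp (-(N / 2 * (log (1 - ε / 2) + ε / 2 * (1 + ε)))) = exp (-(N * δ')) := by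
    rw [hδ']; congr 1; ring
  calc _ ≤ _ := (measureReal_mono hsub (measure_ne_top _ _)).trans (measureReal_union_le _ _)
    _ ≤ exp (-(N * 1)) + exp (-(N * δ)) + exp (-(N * δ')) := by linarith
    _ ≤ _ := by
      rw [add_mul, add_mul]
      exact add_le_add (add_le_add (exp_neg_mul_le one_pos hK1 hN1 h1)
        (exp_neg_mul_le hδ0 hK1 hN1 h1)) (exp_neg_mul_le hδ'0 hK1 hN1 h1)

open Real in
lemma ae_eventually_abs_minEnergy_sub_one_lt {Ω : Type*} [MeasurableSpace Ω] (P : Measure Ω)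
    [IsProbabilityMeasure P] (H : ∀ K N : ℕ, Ω → Matrix (Fin N) (Fin K) ℝ)
    (hlaw : ∀ (K N : ℕ) (i : Fin N) (j : Fin K),
      HasLaw (fun ω => H K N ω i j) (gaussianReal 0 (1 / (N : NNReal))) P)
    (hindep : ∀ K N : ℕ, iIndepFun (fun (p : Fin N × Fin K) (ω : Ω) => H K N ω p.1 p.2) P)
    {c : ℝ} (hc0 : 0 < c) (hc : c < 1 / 2) {ε : ℝ} (hε : 0 < ε) (hε1 : ε < 1) :
    ∀ᵐ ω ∂P, ∀ᶠ p : ℕ × ℕ in atTop, (p.1 : ℝ) / (p.2 * logb 3 p.1) ≤ c →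
      |minEnergy (H p.1 p.2 ω) - 1| < ε := by
  obtain ⟨M, C, hMC⟩ := exists_measureReal_minEnergy_dev_le P H hlaw hindep hc0 hc hε hε1
  -- The conditions on `p` are part of the event, which is therefore empty outside the regime where
  -- the bound holds.
  set B : ℕ × ℕ → Set Ω := fun p => {ω | (M ≤ p.1 ∧ M ≤ p.2 ∧
    (p.1 : ℝ) / (p.2 * logb 3 p.1) ≤ c) ∧ ε ≤ |minEnergy (H p.1 p.2 ω) - 1|} with hB
  have hsum : Summable fun p : ℕ × ℕ => |C| * (1 / (p.1 : ℝ) ^ 2 * (1 / (p.2 : ℝ) ^ 2)) := by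
    have h : Summable fun n : ℕ => 1 / (n : ℝ) ^ 2 := summable_one_div_nat_pow.2 one_lt_two
    exact (h.mul_of_nonneg h (fun _ => by positivity) (fun _ => by positivity)).mul_left _
  have hle (p : ℕ × ℕ) : P (B p) ≤
      ENNReal.ofReal (|C| * (1 / (p.1 : ℝ) ^ 2 * (1 / (p.2 : ℝ) ^ 2))) := by
    by_cases h : M ≤ p.1 ∧ M ≤ p.2 ∧ (p.1 : ℝ) / (p.2 * logb 3 p.1) ≤ c
    · simp only [hB, h, true_and]
      rw [← ofReal_measureReal (measure_ne_top _ _)]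
      refine ENNReal.ofReal_le_ofReal ((hMC p.1 p.2 h.1 h.2.1 h.2.2).trans ?_)
      gcongr
      exact le_abs_self C
    · simp [hB, h]
  have hfin : ∑' p, P (B p) ≠ ⊤ :=
    ne_top_of_le_ne_top hsum.tsum_ofReal_ne_top (ENNReal.tsum_le_tsum hle)
  filter_upwards [ae_finite_setOfPred_mem hfin] with ω hω
  -- Finitely many bad pairs have an upper bound `q` in the product order, and no pair above `q +
  -- (1, 1)` is below `q`.
  obtain ⟨q, hq⟩ := hω.bddAbove
  filter_upwards [eventually_ge_atTop (M, M), eventually_ge_atTop (q + (1, 1))] with p hp hpq hpc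
  by_contra! hcon
  have : p ≤ q := hq ⟨⟨hp.1, hp.2, hpc⟩, hcon⟩
  have := hpq.1.trans this.1
  simp at this

end CDMA

theorem theorem3 {Ω : Type*} [MeasurableSpace Ω] (P : Measure Ω) [IsProbabilityMeasure P]
    (H : ∀ K N : ℕ, Ω → Matrix (Fin N) (Fin K) ℝ)
    (hlaw : ∀ (K N : ℕ) (i : Fin N) (j : Fin K),
      HasLaw (fun ω => H K N ω i j) (gaussianReal 0 (1 / (N : NNReal))) P)
    (hindep : ∀ K N : ℕ, iIndepFun (fun (p : Fin N × Fin K) (ω : Ω) => H K N ω p.1 p.2) P) :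
    ∀ᵐ ω ∂P, ∃ η : ℕ → ℕ → ℝ,
      (∀ K N : ℕ, 1 ≤ K →
        CDMA.IsOptimumAsymptoticEfficiency (H K N ω) (η K N) ∧
        IsLeast (CDMA.errorEnergies (H K N ω)) (η K N)) ∧
      ∀ c : ℝ, c < 1 / 2 →
        Tendsto (fun p : ℕ × ℕ => η p.1 p.2)
          (atTop ⊓ 𝓟 {p : ℕ × ℕ | (p.1 : ℝ) / ((p.2 : ℝ) * Real.logb 3 (p.1 : ℝ)) ≤ c})
          (𝓝 1) := by
  -- Only countably many almost sure events can be intersected, so `c` and `ε` run through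
  -- sequences; the shifts 3 and 2 ensure `0 < c` and `ε < 1`. Every other `c < 1/2`, including `c ≤
  -- 0`, imposes a stronger rate condition than some member of the sequence.
  have h (n m : ℕ) := CDMA.ae_eventually_abs_minEnergy_sub_one_lt P H hlaw hindep
    (c := 1 / 2 - 1 / ((n : ℝ) + 3))
    (by
      have : 1 / ((n : ℝ) + 3) < 1 / 2 := one_div_lt_one_div_of_lt two_pos (by
        linarith [(Nat.cast_nonneg n : (0 : ℝ) ≤ n)])
      linarith)
    (by
      have : 0 < 1 / ((n : ℝ) + 3) := by positivity
      linarith)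
    (ε := 1 / ((m : ℝ) + 2)) (by positivity)
    (by rw [div_lt_one (by positivity)]; linarith [(Nat.cast_nonneg m : (0 : ℝ) ≤ m)])
  filter_upwards [ae_all_iff.2 fun n => ae_all_iff.2 (h n)] with ω hω
  refine ⟨fun K N => CDMA.minEnergy (H K N ω), fun K N hK =>
    ⟨CDMA.isOptimumAsymptoticEfficiency_minEnergy hK _, CDMA.isLeast_minEnergy hK _⟩,
    fun c hc => ?_⟩
  rw [Metric.tendsto_nhds]
  intro ε hε
  obtain ⟨n, hn⟩ := exists_nat_one_div_lt (sub_pos.2 hc)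
  obtain ⟨m, hm⟩ := exists_nat_one_div_lt hε
  rw [eventually_inf_principal]
  filter_upwards [hω n m] with p hp hpc
  have h1 : 1 / ((n : ℝ) + 3) ≤ 1 / ((n : ℝ) + 1) := by gcongr; norm_num
  have h2 : 1 / ((m : ℝ) + 2) ≤ 1 / ((m : ℝ) + 1) := by gcongr; norm_num
  have h3 : (p.1 : ℝ) / (p.2 * Real.logb 3 p.1) ≤ c := hpc
  rw [Real.dist_eq]
  exact (hp (by linarith)).trans_le (by linarith)
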